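/- Let $\mathcal A$ be the quasi-local $C^*$-algebra of a quantum spin system on $\mathbb Z^\mu$ with spin space $\mathbb C^d$ at each site: $\mathcal A$ is a unital $C^*$-algebra, $\mathcal A\neq\{0\}$, generated by mutually commuting unital copies $\mathcal A_{\{x\}}$ of $M_d(\mathbb C)$, $x\in\mathbb Z^\mu$. For finite $\Lambda\subset\mathbb Z^\mu$ let $\mathcal A_\Lambda$ be the $*$-algebra generated by the $\mathcal A_{\{x\}}$, $x\in\Lambda$ (a local observable is an element of some $\mathcal A_\Lambda$). Let $(\tau_x)_{x\in\mathbb Z^\mu}$ be the group of space translations, the $*$-automorphisms of $\mathcal A$ that carry the copy of $M_d(\mathbb C)$ at $y$ identically onto the copy at $y+x$. Write $\Lambda_x(r)=\{y\in\mathbb Z^\mu : |y_i-x_i|\le r \text{ for all } i\}$. Let $(\hat h_x)_{x\in\mathbb Z^\mu}$ be local Hamiltonians of uniformly bounded range and norm: there are $R\in\mathbb N$ and $N\in\mathbb R$ such that for every $x$, $\hat h_x=\hat h_x^*\in\mathcal A_{\Lambda_x(R)}$ and $\|\hat h_x\|\le N$. For finite $\Lambda\subset\mathbb Z^\mu$ put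 $$\hat H_\Lambda=\sum_{x\in\Lambda}\hat h_x,\qquad \alpha_{\Lambda,t}(A)=e^{it\hat H_\Lambda}Ae^{-it\hat H_\Lambda}\quad(A\in\mathcal A,\ t\in\mathbb R).$$ Let $(\alpha_t)_{t\in\mathbb R}$ be a one-parameter group of $*$-automorphisms of $\mathcal A$ which is translation invariant ($\alpha_t\tau_x=\tau_x\alpha_t$ for all $t,x$), strongly continuous ($\lim_{t\to0}\|\alpha_t(A)-A\|=0$ for every $A\in\mathcal A$) and approximately inner ($\alpha_t(A)=\lim_{\Lambda\uparrow\mathbb Z^\mu}\alpha_{\Lambda,t}(A)$ in norm for all $A\in\mathcal A$, $t\in\mathbb R$, along the net of finite subsets ordered by inclusion). Let $A_0$ be a local observable, $A_x=\tau_x(A_0)$, and $\widehat A_\Lambda=\frac1{|\Lambda|}\sum_{x\in\Lambda}A_x$ for nonempty finite $\Lambda$. Then for every $\varepsilon>0$ and $t_0>0$, the estimate $$\bigl\|\alpha_t(\widehat A_\Lambda)-\alpha_{\Lambda,t}(\widehat A_\Lambda)\bigr\|\le\varepsilon\qquad\text{for all } t\in[-t_0,t_0]$$ holds for all sufficiently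 large finite $\Lambda\subset\mathbb Z^\mu$ in the sense of van Hove; that is, there are $m\in\mathbb N$ and $\delta>0$ such that it holds for every nonempty finite $\Lambda$ with $|\{x\in\Lambda:\Lambda_x(m)\not\subset\Lambda\}|\le\delta|\Lambda|$. -/

import Mathlib

open Filter Topology

namespace QuantumSpin

/-- Sites of the cubic lattice `ℤ^μ`. -/
abbrev Lattice (μ : ℕ) : Type := Fin μ → ℤ

/-- The box `{y : |y i - x i| ≤ r for all i}` of radius `r` centered at `x`. -/
noncomputable def box {μ : ℕ} (x : Lattice μ) (r : ℕ) : Finset (Lattice μ) :=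
  Finset.Icc (fun i => x i - (r : ℤ)) (fun i => x i + (r : ℤ))

theorem mem_box {μ : ℕ} {x y : Lattice μ} {r : ℕ} : y ∈ box x r ↔ ∀ i, |y i - x i| ≤ (r : ℤ) := by
  simp only [box, Finset.mem_Icc, Pi.le_def, abs_le, ← forall_and]
  refine forall_congr' fun i => ?_
  omega

/-- A quantum spin system on `ℤ^μ` with spin space `ℂ^d` at each site: a nontrivial unital
C⋆-algebra `A` that contains, for each site, a copy of the full matrix algebra `M_d(ℂ)` (with the
unit of `A` as its unit), such that copies at different sites commute and all the copies together
generate `A` as a C⋆-algebra, together with the space translations, which shift the sites. This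
determines the algebra (as the infinite C⋆-tensor product of copies of `M_d(ℂ)`) and the
translations up to isomorphism. -/
structure SpinSystem (μ d : ℕ) (A : Type*) [CStarAlgebra A] where
  nontrivial : Nontrivial A
  /-- The embedding of the algebra of one site. -/
  site : Lattice μ → (Matrix (Fin d) (Fin d) ℂ →⋆ₐ[ℂ] A)
  commute_site : ∀ x y, x ≠ y → ∀ M N, Commute (site x M) (site y N)
  dense_sites :
    (StarAlgebra.adjoin ℂ (⋃ x, Set.range (site x))).topologicalClosure = ⊤
  /-- The group of space translations `τ_x`. -/
  translation : Multiplicative (Lattice μ) →* (A ≃⋆ₐ[ℂ] A)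
  translation_site : ∀ x y M,
    translation (Multiplicative.ofAdd x) (site y M) = site (y + x) M

namespace SpinSystem

variable {μ d : ℕ} {A : Type*} [CStarAlgebra A] (S : SpinSystem μ d A)

/-- The space translation `τ_x`. -/
def τ (x : Lattice μ) : A ≃⋆ₐ[ℂ] A := S.translation (Multiplicative.ofAdd x)

/-- The algebra `A_Λ` of observables supported in `Λ`, generated by the algebras of the sites
of `Λ`. -/
def localAlgebra (Λ : Finset (Lattice μ)) : StarSubalgebra ℂ A :=
  StarAlgebra.adjoin ℂ (⋃ x ∈ Λ, Set.range (S.site x))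

/-- A local observable: an element of `A_Λ` for some finite `Λ`. -/
def IsLocal (a : A) : Prop := ∃ Λ : Finset (Lattice μ), a ∈ S.localAlgebra Λ

/-- The family `h` of local Hamiltonians is a uniformly bounded finite-range one: each `h x` is
self-adjoint with support in the box of radius `R` centered at `x`, and has norm at most `N`. -/
structure IsLocalHamiltonian (h : Lattice μ → A) (R : ℕ) (N : ℝ) : Prop where
  isSelfAdjoint : ∀ x, IsSelfAdjoint (h x)
  mem_localAlgebra : ∀ x, h x ∈ S.localAlgebra (box x R)
  norm_le : ∀ x, ‖h x‖ ≤ N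

/-- The spatial average `|Λ|⁻¹ ∑_{x ∈ Λ} τ_x(a)`. -/
noncomputable def average (a : A) (Λ : Finset (Lattice μ)) : A :=
  (Λ.card : ℂ)⁻¹ • ∑ x ∈ Λ, S.τ x a

end SpinSystem

section Dynamics

variable {μ : ℕ} {A : Type*} [CStarAlgebra A]

/-- The Hamiltonian `H_Λ = ∑_{x ∈ Λ} h_x` of the finite region `Λ`. -/
def hamiltonian (h : Lattice μ → A) (Λ : Finset (Lattice μ)) : A := ∑ x ∈ Λ, h x

/-- The local (cut-off) Heisenberg time evolution `a ↦ e^{itH_Λ} a e^{-itH_Λ}`. -/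
noncomputable def localEvolution (h : Lattice μ → A) (Λ : Finset (Lattice μ)) (t : ℝ) (a : A) : A :=
  NormedSpace.exp ((Complex.I * (t : ℂ)) • hamiltonian h Λ) * a *
    NormedSpace.exp (-((Complex.I * (t : ℂ)) • hamiltonian h Λ))

/-- A one-parameter group of ⋆-automorphisms of `A`. -/
abbrev TimeEvolution (A : Type*) [CStarAlgebra A] : Type _ :=
  Multiplicative ℝ →* (A ≃⋆ₐ[ℂ] A)

/-- The automorphism `α_t`. -/
def TimeEvolution.at (α : TimeEvolution A) (t : ℝ) : A ≃⋆ₐ[ℂ] A := α (Multiplicative.ofAdd t)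

/-- Strong continuity: `α_t(a) → a` in norm as `t → 0`, for each `a`. -/
def TimeEvolution.IsStronglyContinuous (α : TimeEvolution A) : Prop :=
  ∀ a : A, Tendsto (fun t : ℝ => α.at t a) (𝓝 0) (𝓝 a)

/-- The evolution commutes with all space translations. -/
def TimeEvolution.IsTranslationInvariant {d : ℕ} (α : TimeEvolution A) (S : SpinSystem μ d A) :
    Prop :=
  ∀ (t : ℝ) (x : Lattice μ) (a : A), α.at t (S.τ x a) = S.τ x (α.at t a)

/-- The evolution is approximately inner with respect to `h`: `α_t(a)` is the norm limit of
`α_{Λ,t}(a)` along the net of finite regions `Λ` directed by inclusion, for each `a` and `t`. -/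
def TimeEvolution.IsApproximatelyInner (α : TimeEvolution A) (h : Lattice μ → A) : Prop :=
  ∀ (a : A) (t : ℝ),
    Tendsto (fun Λ : Finset (Lattice μ) => localEvolution h Λ t a) atTop
      (𝓝 (α.at t a))

end Dynamics

/-- The sites of `Λ` whose box of radius `m` is not contained in `Λ`. -/
noncomputable def boundary {μ : ℕ} (m : ℕ) (Λ : Finset (Lattice μ)) : Finset (Lattice μ) :=
  {x ∈ Λ | ¬ box x m ⊆ Λ}

/-- The filter of the van Hove limit on nonempty finite regions `Λ`: for every `m`, the fraction of
sites of `Λ` within distance `m` of the complement of `Λ` tends to zero. -/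
noncomputable def vanHove (μ : ℕ) : Filter (Finset (Lattice μ)) :=
  (⨅ m : ℕ, comap (fun Λ => ((boundary m Λ).card : ℝ) / (Λ.card : ℝ)) (𝓝 0)) ⊓
    𝓟 {Λ | Λ.Nonempty}

end QuantumSpin

/-! ### Boxes, local algebras and the two evolutions -/

namespace QuantumSpin

/-! The point is locality uniform in position: for each observable `a` and time bound `T` there is
one `m` such that `α_t` and `α_{Λ,t}` nearly agree on `τ_x a` for `|t| ≤ T` whenever `box x m ⊆ Λ`
(`isUniformlyApproximated`). In the average, interior sites are then good, and boundary sites, each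
costing at most `2‖A₀‖`, are a vanishing fraction of `Λ`.

For short times, iterated commutators of a local observable with the Hamiltonian do not see the far
region, and the remainder of the iteration decays geometrically (`norm_localEvolution_sub_le`). This
compares two finite regions; letting one grow brings in `α`, and density of local observables gives
every `a`.

Longer times come from doubling (`two_mul`), since `α_s α_s - α_{Λ,s} α_{Λ,s} = (α_s - α_{Λ,s}) α_s
+ α_{Λ,s} (α_s - α_{Λ,s})`. The observables `α_s a` vary with `s` and need not be local, but by
strong continuity they fill a compact set, and by translation invariance `α_s τ_x a = τ_x (α_s a)`,
so one `m` still serves all of them. The Hamiltonians `h x` themselves need not be translates of one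
another. -/

theorem card_box {μ : ℕ} (x : Lattice μ) (r : ℕ) : (box x r).card = (2 * r + 1) ^ μ := by
  have h : ∀ i : Fin μ, (x i + (r : ℤ) + 1 - (x i - (r : ℤ))).toNat = 2 * r + 1 := fun i => by omega
  simp [box, Pi.card_Icc, Int.card_Icc, h]

theorem box_mono {μ : ℕ} (x : Lattice μ) {r s : ℕ} (hrs : r ≤ s) : box x r ⊆ box x s := by
  intro y hy
  rw [mem_box] at hy ⊢
  exact fun i => (hy i).trans (by exact_mod_cast hrs)

theorem box_subset_box_add {μ : ℕ} {x y : Lattice μ} {r s : ℕ} (hy : y ∈ box x r) :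
    box y s ⊆ box x (r + s) := by
  intro z hz
  rw [mem_box] at hy hz ⊢
  intro i
  have h₁ := abs_le.1 (hy i)
  have h₂ := abs_le.1 (hz i)
  rw [abs_le]
  push_cast
  constructor <;> linarith [h₁.1, h₁.2, h₂.1, h₂.2]

theorem mem_box_comm {μ : ℕ} {x y : Lattice μ} {r : ℕ} : y ∈ box x r ↔ x ∈ box y r := by
  simp only [mem_box, abs_sub_comm]

theorem exists_subset_box {μ : ℕ} (X : Finset (Lattice μ)) : ∃ r, X ⊆ box 0 r := by
  refine ⟨X.sup fun y => Finset.univ.sup fun i => (y i).natAbs, fun y hy => mem_box.2 fun i => ?_⟩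
  have h₁ : (y i).natAbs ≤ Finset.univ.sup fun i => (y i).natAbs :=
    Finset.le_sup (f := fun i => (y i).natAbs) (Finset.mem_univ i)
  have h₂ := Finset.le_sup (f := fun y : Lattice μ => Finset.univ.sup fun i => (y i).natAbs) hy
  have h₃ := h₁.trans h₂
  rw [Pi.zero_apply, sub_zero, Int.abs_eq_natAbs]
  exact_mod_cast h₃

namespace SpinSystem

variable {μ d : ℕ} {A : Type*} [CStarAlgebra A] (S : SpinSystem μ d A)

theorem localAlgebra_mono {X Y : Finset (Lattice μ)} (h : X ⊆ Y) :
    S.localAlgebra X ≤ S.localAlgebra Y :=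
  StarAlgebra.adjoin_mono (Set.biUnion_subset_biUnion_left h)

theorem commute_of_disjoint {X Y : Finset (Lattice μ)} (hXY : Disjoint X Y) {a b : A}
    (ha : a ∈ S.localAlgebra X) (hb : b ∈ S.localAlgebra Y) : Commute a b := by
  have key : ∀ y ∈ Y, ∀ M, Commute a (S.site y M) := by
    intro y hy
    induction ha using StarAlgebra.adjoin_induction with
    | mem a h =>
      simp only [Set.mem_iUnion, Set.mem_range] at h
      obtain ⟨x, hx, L, rfl⟩ := h
      exact S.commute_site x y (fun e => Finset.disjoint_left.1 hXY hx (e ▸ hy)) L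
    | algebraMap r => exact fun M => Algebra.commutes r _
    | add _ _ _ _ h₁ h₂ => exact fun M => (h₁ M).add_left (h₂ M)
    | mul _ _ _ _ h₁ h₂ => exact fun M => (h₁ M).mul_left (h₂ M)
    | star _ _ h =>
      intro M
      have := (h (star M)).star_star
      rwa [← map_star, star_star] at this
  have ha' := star_mem ha
  have key' : ∀ y ∈ Y, ∀ M, Commute (star a) (S.site y M) := by
    intro y hy M
    have := (key y hy (star M)).star_star
    rwa [← map_star, star_star] at this
  -- The star case of the induction on `b` turns commutation with `star a` into commutation with
  -- `a`, so both are carried along.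
  suffices h : Commute a b ∧ Commute (star a) b from h.1
  clear ha ha'
  induction hb using StarAlgebra.adjoin_induction with
  | mem b h =>
    simp only [Set.mem_iUnion, Set.mem_range] at h
    obtain ⟨y, hy, M, rfl⟩ := h
    exact ⟨key y hy M, key' y hy M⟩
  | algebraMap r => exact ⟨(Algebra.commutes r _).symm, (Algebra.commutes r _).symm⟩
  | add _ _ _ _ h₁ h₂ => exact ⟨h₁.1.add_right h₂.1, h₁.2.add_right h₂.2⟩
  | mul _ _ _ _ h₁ h₂ => exact ⟨h₁.1.mul_right h₂.1, h₁.2.mul_right h₂.2⟩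
  | star _ _ h =>
    refine ⟨?_, h.1.star_star⟩
    simpa using h.2.star_star

theorem τ_mem_localAlgebra (x : Lattice μ) {X Y : Finset (Lattice μ)}
    (hXY : ∀ y ∈ X, y + x ∈ Y) {a : A} (ha : a ∈ S.localAlgebra X) :
    S.τ x a ∈ S.localAlgebra Y := by
  induction ha using StarAlgebra.adjoin_induction with
  | mem a h =>
    simp only [Set.mem_iUnion, Set.mem_range] at h
    obtain ⟨y, hy, M, rfl⟩ := h
    refine StarAlgebra.subset_adjoin ℂ _ ?_
    simp only [Set.mem_iUnion, Set.mem_range]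
    exact ⟨y + x, hXY y hy, M, (S.translation_site x y M).symm⟩
  | algebraMap r =>
    rw [AlgHomClass.commutes]
    exact algebraMap_mem _ r
  | add _ _ _ _ h₁ h₂ => rw [map_add]; exact add_mem h₁ h₂
  | mul _ _ _ _ h₁ h₂ => rw [map_mul]; exact mul_mem h₁ h₂
  | star _ _ h => rw [map_star]; exact star_mem h

theorem isLocal_of_mem_adjoin {a : A}
    (ha : a ∈ StarAlgebra.adjoin ℂ (⋃ x, Set.range (S.site x))) : S.IsLocal a := by
  classical
  induction ha using StarAlgebra.adjoin_induction with
  | mem a h =>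
    obtain ⟨x, hx⟩ := Set.mem_iUnion.1 h
    refine ⟨{x}, StarAlgebra.subset_adjoin ℂ _ ?_⟩
    simpa using hx
  | algebraMap r => exact ⟨∅, algebraMap_mem _ r⟩
  | add _ _ _ _ h₁ h₂ =>
    obtain ⟨X, hX⟩ := h₁
    obtain ⟨Y, hY⟩ := h₂
    exact ⟨X ∪ Y, add_mem (S.localAlgebra_mono Finset.subset_union_left hX)
      (S.localAlgebra_mono Finset.subset_union_right hY)⟩
  | mul _ _ _ _ h₁ h₂ =>
    obtain ⟨X, hX⟩ := h₁
    obtain ⟨Y, hY⟩ := h₂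
    exact ⟨X ∪ Y, mul_mem (S.localAlgebra_mono Finset.subset_union_left hX)
      (S.localAlgebra_mono Finset.subset_union_right hY)⟩
  | star _ _ h =>
    obtain ⟨X, hX⟩ := h
    exact ⟨X, star_mem hX⟩

theorem exists_isLocal_norm_sub_lt (a : A) {ε : ℝ} (hε : 0 < ε) :
    ∃ b, S.IsLocal b ∧ ‖a - b‖ < ε := by
  have ha : a ∈ closure (StarAlgebra.adjoin ℂ (⋃ x, Set.range (S.site x)) : Set A) := by
    rw [← StarSubalgebra.topologicalClosure_coe, S.dense_sites]
    trivial
  obtain ⟨b, hb, hab⟩ := Metric.mem_closure_iff.1 ha ε hε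
  exact ⟨b, S.isLocal_of_mem_adjoin hb, by rwa [← dist_eq_norm]⟩

theorem norm_τ (x : Lattice μ) (a : A) : ‖S.τ x a‖ = ‖a‖ :=
  StarAlgEquiv.norm_map _ a

end SpinSystem

theorem TimeEvolution.norm_at {A : Type*} [CStarAlgebra A] (α : TimeEvolution A) (t : ℝ) (a : A) :
    ‖α.at t a‖ = ‖a‖ :=
  StarAlgEquiv.norm_map _ a

theorem TimeEvolution.at_add {A : Type*} [CStarAlgebra A] (α : TimeEvolution A) (s t : ℝ) (a : A) :
    α.at (s + t) a = α.at s (α.at t a) := by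
  simp only [TimeEvolution.at, ofAdd_add, map_mul, StarAlgEquiv.mul_apply]

theorem TimeEvolution.IsStronglyContinuous.continuous {A : Type*} [CStarAlgebra A]
    {α : TimeEvolution A} (hα : α.IsStronglyContinuous) (a : A) :
    Continuous fun t : ℝ => α.at t a := by
  refine continuous_iff_continuousAt.2 fun s => ?_
  have h : Tendsto (fun t : ℝ => α.at (t - s) a) (𝓝 s) (𝓝 a) :=
    (hα a).comp (by simpa using (continuous_sub_right s).tendsto s)
  rw [tendsto_iff_norm_sub_tendsto_zero] at h
  rw [ContinuousAt, tendsto_iff_norm_sub_tendsto_zero]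
  refine h.congr fun t => ?_
  rw [← α.norm_at s (α.at (t - s) a - a), map_sub, ← α.at_add, add_sub_cancel]

section LocalEvolution

variable {μ : ℕ} {A : Type*} [CStarAlgebra A] (h : Lattice μ → A) (Λ : Finset (Lattice μ))

theorem localEvolution_sub (t : ℝ) (a b : A) :
    localEvolution h Λ t (a - b) = localEvolution h Λ t a - localEvolution h Λ t b := by
  simp only [localEvolution, mul_sub, sub_mul]

theorem localEvolution_smul (t : ℝ) (c : ℂ) (a : A) :
    localEvolution h Λ t (c • a) = c • localEvolution h Λ t a := by
  simp only [localEvolution, mul_smul_comm, smul_mul_assoc]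

theorem localEvolution_sum {ι : Type*} (s : Finset ι) (t : ℝ) (a : ι → A) :
    localEvolution h Λ t (∑ i ∈ s, a i) = ∑ i ∈ s, localEvolution h Λ t (a i) := by
  simp only [localEvolution, Finset.mul_sum, Finset.sum_mul]

theorem localEvolution_zero (a : A) : localEvolution h Λ 0 a = a := by
  simp [localEvolution, NormedSpace.exp_zero]

theorem localEvolution_add (s t : ℝ) (a : A) :
    localEvolution h Λ (s + t) a = localEvolution h Λ s (localEvolution h Λ t a) := by
  let +nondep : NormedAlgebra ℚ A := NormedAlgebra.restrictScalars ℚ ℂ A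
  simp only [localEvolution]
  set H := hamiltonian h Λ
  have hc : Commute ((Complex.I * (s : ℂ)) • H) ((Complex.I * (t : ℂ)) • H) :=
    ((Commute.refl H).smul_left _).smul_right _
  have e : (Complex.I * ((s + t : ℝ) : ℂ)) • H
      = (Complex.I * (s : ℂ)) • H + (Complex.I * (t : ℂ)) • H := by
    rw [← add_smul]; push_cast; ring_nf
  have e' : -((Complex.I * ((s + t : ℝ) : ℂ)) • H)
      = -((Complex.I * (t : ℂ)) • H) + -((Complex.I * (s : ℂ)) • H) := by
    rw [e, neg_add_rev]
  rw [e', e, NormedSpace.exp_add_of_commute hc,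
    NormedSpace.exp_add_of_commute hc.symm.neg_left.neg_right]
  simp only [mul_assoc]

/-- Lets estimates for nonnegative times, proved for every `h`, cover negative ones. -/
theorem localEvolution_neg (t : ℝ) (a : A) :
    localEvolution h Λ (-t) a = localEvolution (-h) Λ t a := by
  simp [localEvolution, hamiltonian]

variable {h} in
theorem norm_localEvolution (hh : ∀ x, IsSelfAdjoint (h x)) (t : ℝ) (a : A) :
    ‖localEvolution h Λ t a‖ = ‖a‖ := by
  have hH : IsSelfAdjoint (t • hamiltonian h Λ) :=
    (IsSelfAdjoint.all t).smul (isSelfAdjoint_sum Λ fun x _ => hh x)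
  have e₁ : (Complex.I * (t : ℂ)) • hamiltonian h Λ
      = Complex.I • (t • hamiltonian h Λ) := by
    rw [mul_smul, Complex.coe_smul]
  have e : NormedSpace.exp ((Complex.I * (t : ℂ)) • hamiltonian h Λ)
      = (selfAdjoint.expUnitary ⟨_, hH⟩ : A) := by
    rw [selfAdjoint.expUnitary_coe, e₁]
  have e' : NormedSpace.exp (-((Complex.I * (t : ℂ)) • hamiltonian h Λ))
      = (selfAdjoint.expUnitary (-⟨_, hH⟩) : A) := by
    rw [selfAdjoint.expUnitary_coe, e₁]
    simp
  rw [localEvolution, e, e', CStarRing.norm_mul_coe_unitary, CStarRing.norm_coe_unitary_mul]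

theorem hasDerivAt_localEvolution (t : ℝ) (a : A) :
    HasDerivAt (fun s : ℝ => localEvolution h Λ s a)
      (localEvolution h Λ t
        (Complex.I • (hamiltonian h Λ * a - a * hamiltonian h Λ))) t := by
  set H := Complex.I • hamiltonian h Λ with hH
  have e : ∀ s : ℝ, (Complex.I * (s : ℂ)) • hamiltonian h Λ = s • H := fun s => by
    rw [mul_comm, mul_smul, Complex.coe_smul]
  have h₁ := hasDerivAt_exp_smul_const (𝕂 := ℝ) H t
  have h₂ := hasDerivAt_exp_smul_const' (𝕂 := ℝ) (-H) t
  have h₃ := (h₁.mul_const a).fun_mul h₂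
  have h₄ : Complex.I • (hamiltonian h Λ * a - a * hamiltonian h Λ) = H * a - a * H := by
    rw [hH, smul_sub, smul_mul_assoc, mul_smul_comm]
  simp only [smul_neg] at h₃
  simp only [localEvolution, e, h₄]
  refine h₃.congr_deriv ?_
  noncomm_ring

end LocalEvolution

end QuantumSpin

/-! ### Short-time comparison of two finite regions -/

namespace QuantumSpin

variable {μ d : ℕ} {A : Type*} [CStarAlgebra A] {S : SpinSystem μ d A}
  {h : Lattice μ → A} {R : ℕ} {N : ℝ}

namespace SpinSystem.IsLocalHamiltonian

theorem nonneg (hh : S.IsLocalHamiltonian h R N) : 0 ≤ N :=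
  (norm_nonneg _).trans (hh.norm_le 0)

theorem neg (hh : S.IsLocalHamiltonian h R N) : S.IsLocalHamiltonian (-h) R N where
  isSelfAdjoint x := (hh.isSelfAdjoint x).neg
  mem_localAlgebra x := neg_mem (hh.mem_localAlgebra x)
  norm_le x := by simpa using hh.norm_le x

theorem norm_commutator_le (hh : S.IsLocalHamiltonian h R N) (y : Lattice μ) (a : A) :
    ‖Complex.I • (h y * a - a * h y)‖ ≤ 2 * N * ‖a‖ := by
  have h₁ : ‖h y * a‖ ≤ N * ‖a‖ := (norm_mul_le _ _).trans (by gcongr; exact hh.norm_le y)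
  have h₂ : ‖a * h y‖ ≤ ‖a‖ * N := (norm_mul_le _ _).trans (by gcongr; exact hh.norm_le y)
  rw [norm_smul, Complex.norm_I, one_mul]
  linarith [norm_sub_le (h y * a) (a * h y)]

/-- The commutator with the Hamiltonian of a local observable only involves the interaction terms
near its support. -/
theorem commutator_hamiltonian (hh : S.IsLocalHamiltonian h R N) {X Λ : Finset (Lattice μ)}
    {a : A} (ha : a ∈ S.localAlgebra X) (hΛ : X.biUnion (box · R) ⊆ Λ) :
    Complex.I • (hamiltonian h Λ * a - a * hamiltonian h Λ)
      = ∑ y ∈ X.biUnion (box · R), Complex.I • (h y * a - a * h y) := by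
  rw [← Finset.smul_sum, hamiltonian, Finset.sum_mul, Finset.mul_sum, ← Finset.sum_sub_distrib]
  congr 1
  refine (Finset.sum_subset hΛ fun y _ hy => ?_).symm
  rw [sub_eq_zero]
  refine (S.commute_of_disjoint ?_ (hh.mem_localAlgebra y) ha).eq
  rw [Finset.disjoint_left]
  intro z hz hzX
  exact hy (Finset.mem_biUnion.2 ⟨z, hzX, mem_box_comm.1 hz⟩)

/-- Comparison of the evolutions in two regions that both contain a large neighbourhood of the
support of the observable. -/
theorem norm_localEvolution_sub_le (hh : S.IsLocalHamiltonian h R N) {Λ Λ' : Finset (Lattice μ)}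
    {x : Lattice μ} (n : ℕ) : ∀ (r p : ℕ) (X : Finset (Lattice μ)) (a : A),
    a ∈ S.localAlgebra X → X ⊆ box x r → X.card ≤ p * (2 * R + 1) ^ μ →
    box x (r + 2 * R * n) ⊆ Λ → box x (r + 2 * R * n) ⊆ Λ' → ∀ t : ℝ, 0 ≤ t →
    ‖localEvolution h Λ t a - localEvolution h Λ' t a‖
      ≤ 2 * ‖a‖ * (2 * N * ((2 * R + 1) ^ μ) ^ 2) ^ n
        * (p.ascFactorial n / n.factorial) * t ^ n := by
  classical
  -- Here `p` measures the support in units of the box volume. Each commutator raises `p` by one and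
  -- the radius by `2 * R`, so `r`, `p`, `X` and `a` must stay general.
  induction n with
  | zero =>
    intro r p X a _ _ _ _ _ t _
    have := norm_sub_le (localEvolution h Λ t a) (localEvolution h Λ' t a)
    rw [norm_localEvolution Λ hh.isSelfAdjoint, norm_localEvolution Λ' hh.isSelfAdjoint] at this
    simpa [two_mul] using this
  | succ n ih =>
    intro r p X a ha hX hcard hΛ hΛ' t ht
    set V : ℕ := (2 * R + 1) ^ μ with hV
    have hVR : ((2 * R + 1 : ℝ)) ^ μ = V := by rw [hV]; push_cast; rfl
    simp only [hVR] at ih ⊢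
    have hN := hh.nonneg
    set Y := X.biUnion (box · R) with hY
    have hYcard : (Y.card : ℝ) ≤ p * V * V := by
      have h₁ : Y.card ≤ X.card * V :=
        Finset.card_biUnion_le_card_mul _ _ _ fun y _ => (card_box y R).le
      exact_mod_cast h₁.trans (Nat.mul_le_mul_right _ hcard)
    have hYbox : ∀ y ∈ Y, y ∈ box x (r + R) := by
      intro y hy
      obtain ⟨z, hz, hyz⟩ := Finset.mem_biUnion.1 hy
      exact box_subset_box_add (hX hz) hyz
    have hsub : r + R ≤ r + 2 * R * (n + 1) := by nlinarith [Nat.zero_le (R * n)]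
    have hYΛ : Y ⊆ Λ := fun y hy => hΛ (box_mono x hsub (hYbox y hy))
    have hYΛ' : Y ⊆ Λ' := fun y hy => hΛ' (box_mono x hsub (hYbox y hy))
    set b : Lattice μ → A := fun y => Complex.I • (h y * a - a * h y) with hb
    -- Both Hamiltonians have the same commutator with `a`, so the derivative is again a sum of
    -- differences of the two evolutions on common observables.
    have hder : ∀ s : ℝ,
        HasDerivAt (fun s : ℝ => localEvolution h Λ s a - localEvolution h Λ' s a)
          (∑ y ∈ Y, (localEvolution h Λ s (b y) - localEvolution h Λ' s (b y))) s := by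
      intro s
      have := (hasDerivAt_localEvolution h Λ s a).sub (hasDerivAt_localEvolution h Λ' s a)
      rw [hh.commutator_hamiltonian ha hYΛ, hh.commutator_hamiltonian ha hYΛ',
        localEvolution_sum, localEvolution_sum, ← Finset.sum_sub_distrib] at this
      exact this
    have hbound : ∀ s : ℝ, 0 ≤ s →
        ‖∑ y ∈ Y, (localEvolution h Λ s (b y) - localEvolution h Λ' s (b y))‖
          ≤ 2 * ‖a‖ * (2 * N * (V : ℝ) ^ 2) ^ (n + 1)
            * (p.ascFactorial (n + 1) / n.factorial) * s ^ n := by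
      intro s hs
      have hterm : ∀ y ∈ Y, ‖localEvolution h Λ s (b y) - localEvolution h Λ' s (b y)‖
          ≤ 2 * (2 * N * ‖a‖) * (2 * N * (V : ℝ) ^ 2) ^ n
            * ((p + 1).ascFactorial n / n.factorial) * s ^ n := by
        intro y hy
        have hmem : b y ∈ S.localAlgebra (X ∪ box y R) := by
          have h₁ := S.localAlgebra_mono Finset.subset_union_left (Y := X ∪ box y R) ha
          have h₂ := S.localAlgebra_mono Finset.subset_union_right (Y := X ∪ box y R)
            (hh.mem_localAlgebra y)
          exact SMulMemClass.smul_mem _ (sub_mem (mul_mem h₂ h₁) (mul_mem h₁ h₂))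
        have hsub' : X ∪ box y R ⊆ box x (r + 2 * R) := by
          refine Finset.union_subset (hX.trans (box_mono x (by omega))) ?_
          have := box_subset_box_add (s := R) (hYbox y hy)
          rwa [show r + R + R = r + 2 * R by ring] at this
        have hc : (X ∪ box y R).card ≤ (p + 1) * V := by
          refine (Finset.card_union_le _ _).trans ?_
          rw [card_box, add_mul, one_mul]
          exact Nat.add_le_add_right hcard _
        have e : r + 2 * R + 2 * R * n = r + 2 * R * (n + 1) := by ring
        refine (ih (r + 2 * R) (p + 1) _ (b y) hmem hsub' hc (e ▸ hΛ) (e ▸ hΛ') s hs).trans ?_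
        gcongr
        exact hh.norm_commutator_le y a
      refine (norm_sum_le_of_le _ hterm).trans ?_
      rw [Finset.sum_const, nsmul_eq_mul]
      refine (mul_le_mul_of_nonneg_right hYcard (by positivity)).trans (le_of_eq ?_)
      -- There are at most `p * V ^ 2` terms; the factor `p` extends the rising factorial downwards.
      have e : ((p : ℝ) * (p + 1).ascFactorial n) = p.ascFactorial (n + 1) := by
        rw [Nat.ascFactorial_succ, ← Nat.succ_ascFactorial]
        push_cast
        rfl
      rw [← e]
      ring
    have hB : ∀ s : ℝ, HasDerivAt
        (fun s : ℝ => 2 * ‖a‖ * (2 * N * (V : ℝ) ^ 2) ^ (n + 1)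
          * (p.ascFactorial (n + 1) / (n + 1).factorial) * s ^ (n + 1))
        (2 * ‖a‖ * (2 * N * (V : ℝ) ^ 2) ^ (n + 1)
            * (p.ascFactorial (n + 1) / n.factorial) * s ^ n) s := by
      intro s
      refine ((hasDerivAt_pow (n + 1) s).const_mul _).congr_deriv ?_
      have : (n.factorial : ℝ) ≠ 0 := by positivity
      have : (n + 1 : ℝ) ≠ 0 := by positivity
      rw [Nat.factorial_succ]
      push_cast
      field_simp
    -- The difference vanishes at time zero, so the bound on its derivative integrates.
    refine image_norm_le_of_norm_deriv_right_le_deriv_boundary (a := 0) (b := t)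
      (fun s _ => (hder s).continuousAt.continuousWithinAt)
      (fun s _ => (hder s).hasDerivWithinAt) ?_ hB (fun s hs => hbound s hs.1) ⟨ht, le_rfl⟩
    simp [localEvolution_zero]

/-- For short times, the evolutions in two regions containing a large box around the support of a
local observable are close, uniformly in the position of the observable. -/
theorem exists_forall_norm_localEvolution_sub_le (hh : S.IsLocalHamiltonian h R N) (r p : ℕ)
    (C : ℝ) {ε : ℝ} (hε : 0 < ε) :
    ∃ m : ℕ, ∀ (x : Lattice μ) (X Λ Λ' : Finset (Lattice μ)) (a : A),
      a ∈ S.localAlgebra X → X ⊆ box x r → X.card ≤ p → ‖a‖ ≤ C → box x m ⊆ Λ → box x m ⊆ Λ' →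
      ∀ t : ℝ, |t| * (8 * N * ((2 * R + 1) ^ μ) ^ 2) ≤ 1 →
      ‖localEvolution h Λ t a - localEvolution h Λ' t a‖ ≤ ε := by
  set K : ℝ := 2 * N * ((2 * R + 1) ^ μ) ^ 2 with hK
  have hN := hh.nonneg
  have hK0 : 0 ≤ K := by positivity
  obtain ⟨n, hn⟩ : ∃ n : ℕ, 2 * C * 2 ^ p * (1 / 2 : ℝ) ^ n ≤ ε := by
    have : Tendsto (fun n : ℕ => 2 * C * 2 ^ p * (1 / 2 : ℝ) ^ n) atTop (𝓝 0) := by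
      simpa using (tendsto_pow_atTop_nhds_zero_of_lt_one (by norm_num) (by norm_num :
        (1 / 2 : ℝ) < 1)).const_mul (2 * C * 2 ^ p)
    exact (this.eventually (ge_mem_nhds hε)).exists
  refine ⟨r + 2 * R * n, fun x X Λ Λ' a ha hX hcard hC hΛ hΛ' t ht => ?_⟩
  have hcard' : X.card ≤ p * (2 * R + 1) ^ μ :=
    hcard.trans (Nat.le_mul_of_pos_right _ (by positivity))
  have key : ‖localEvolution h Λ t a - localEvolution h Λ' t a‖
      ≤ 2 * ‖a‖ * K ^ n * (p.ascFactorial n / n.factorial) * |t| ^ n := by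
    rcases le_total 0 t with h0 | h0
    · rw [abs_of_nonneg h0]
      exact hh.norm_localEvolution_sub_le n r p X a ha hX hcard' hΛ hΛ' t h0
    · have := hh.neg.norm_localEvolution_sub_le n r p X a ha hX hcard' hΛ hΛ' (-t) (by linarith)
      rwa [← localEvolution_neg, ← localEvolution_neg, neg_neg, ← abs_of_nonpos h0] at this
  refine key.trans (le_trans ?_ hn)
  -- The quotient is a binomial coefficient, hence only exponential in `n`; this gives a positive
  -- time radius.
  have hasc : (p.ascFactorial n / n.factorial : ℝ) ≤ 2 ^ p * 2 ^ n := by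
    rw [div_le_iff₀ (by positivity), ← pow_add, mul_comm]
    rw [Nat.ascFactorial_eq_factorial_mul_choose']
    have h₁ : (p + n - 1).choose n ≤ 2 ^ (p + n) :=
      (Nat.choose_le_two_pow _ _).trans (Nat.pow_le_pow_right (by norm_num) (by omega))
    exact_mod_cast Nat.mul_le_mul_left _ h₁
  -- A quarter beats the factor `2 ^ n` and leaves `(1 / 2) ^ n`.
  have hKt : |t| * K ≤ 1 / 4 := by
    have : |t| * (8 * N * ((2 * R + 1) ^ μ) ^ 2) = 4 * (|t| * K) := by rw [hK]; ring
    linarith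
  have hC0 : 0 ≤ C := (norm_nonneg a).trans hC
  calc 2 * ‖a‖ * K ^ n * (p.ascFactorial n / n.factorial) * |t| ^ n
      ≤ 2 * C * K ^ n * (2 ^ p * 2 ^ n) * |t| ^ n := by gcongr
    _ = 2 * C * 2 ^ p * (2 ^ n * (|t| * K) ^ n) := by rw [mul_pow]; ring
    _ ≤ 2 * C * 2 ^ p * (2 ^ n * (1 / 4) ^ n) := by gcongr
    _ = 2 * C * 2 ^ p * (1 / 2 : ℝ) ^ n := by rw [← mul_pow]; norm_num

end SpinSystem.IsLocalHamiltonian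

end QuantumSpin

/-! ### Uniform approximation up to arbitrary times, and averages -/

namespace QuantumSpin

variable {μ d : ℕ} {A : Type*} [CStarAlgebra A] {S : SpinSystem μ d A}
  {h : Lattice μ → A} {R : ℕ} {N : ℝ} {α : TimeEvolution A}

/-- Up to time `T`, the evolution `α` of a translate of any observable is approximated by the local
evolutions in regions containing a large box, uniformly in the position of the box. -/
def TimeEvolution.IsUniformlyApproximated (α : TimeEvolution A) (S : SpinSystem μ d A)
    (h : Lattice μ → A) (T : ℝ) : Prop :=
  ∀ a : A, ∀ ε > 0, ∃ m : ℕ, ∀ (x : Lattice μ) (Λ : Finset (Lattice μ)), box x m ⊆ Λ →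
    ∀ t : ℝ, |t| ≤ T → ‖α.at t (S.τ x a) - localEvolution h Λ t (S.τ x a)‖ ≤ ε

theorem norm_at_sub_localEvolution_le (hh : ∀ x, IsSelfAdjoint (h x)) (Λ : Finset (Lattice μ))
    (t : ℝ) (a b : A) :
    ‖α.at t a - localEvolution h Λ t a‖
      ≤ ‖α.at t b - localEvolution h Λ t b‖ + 2 * ‖a - b‖ := by
  have e : α.at t a - localEvolution h Λ t a
      = (α.at t b - localEvolution h Λ t b)
        + (α.at t (a - b) - localEvolution h Λ t (a - b)) := by
    rw [map_sub, localEvolution_sub]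
    abel
  have h₁ := norm_sub_le (α.at t (a - b)) (localEvolution h Λ t (a - b))
  rw [α.norm_at, norm_localEvolution Λ hh] at h₁
  rw [e]
  linarith [norm_add_le (α.at t b - localEvolution h Λ t b)
    (α.at t (a - b) - localEvolution h Λ t (a - b))]

theorem isUniformlyApproximated_of_mul_le_one (hh : S.IsLocalHamiltonian h R N)
    (hα : α.IsApproximatelyInner h) {T : ℝ}
    (hT : T * (8 * N * ((2 * R + 1) ^ μ) ^ 2) ≤ 1) : α.IsUniformlyApproximated S h T := by
  classical
  intro a ε hε
  obtain ⟨b, ⟨X, hX⟩, hab⟩ := S.exists_isLocal_norm_sub_lt a (ε := ε / 4) (by linarith)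
  obtain ⟨r, hr⟩ := exists_subset_box X
  obtain ⟨m, hm⟩ := hh.exists_forall_norm_localEvolution_sub_le r X.card ‖b‖
    (ε := ε / 2) (by linarith)
  refine ⟨m, fun x Λ hΛ t ht => ?_⟩
  have hN := hh.nonneg
  have ht' : |t| * (8 * N * ((2 * R + 1) ^ μ) ^ 2) ≤ 1 :=
    (mul_le_mul_of_nonneg_right ht (by positivity)).trans hT
  have hmem : S.τ x b ∈ S.localAlgebra (X.image (· + x)) :=
    S.τ_mem_localAlgebra x (fun y hy => Finset.mem_image_of_mem _ hy) hX
  have hbox : X.image (· + x) ⊆ box x r := by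
    intro z hz
    obtain ⟨y, hy, rfl⟩ := Finset.mem_image.1 hz
    rw [mem_box]
    simpa [mem_box] using mem_box.1 (hr hy)
  -- `Λ` stays fixed while the other region exhausts the lattice; `m` does not depend on that
  -- region.
  have hlim : ‖α.at t (S.τ x b) - localEvolution h Λ t (S.τ x b)‖ ≤ ε / 2 := by
    refine le_of_tendsto ((hα (S.τ x b) t).sub_const (localEvolution h Λ t (S.τ x b))).norm ?_
    filter_upwards [eventually_ge_atTop Λ] with Λ' hΛ'
    exact hm x _ Λ' Λ _ hmem hbox Finset.card_image_le (S.norm_τ x b).le (hΛ.trans hΛ') hΛ t ht'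
  have := norm_at_sub_localEvolution_le (α := α) hh.isSelfAdjoint Λ t (S.τ x a) (S.τ x b)
  rw [← map_sub, S.norm_τ] at this
  linarith

namespace TimeEvolution.IsUniformlyApproximated

/-- A finite `ε / 4`-net suffices, because both evolutions and the translations are isometric. -/
theorem exists_forall_mem_of_isCompact (hh : ∀ x, IsSelfAdjoint (h x)) {T : ℝ}
    (hα : α.IsUniformlyApproximated S h T) {K : Set A} (hK : IsCompact K) {ε : ℝ} (hε : 0 < ε) :
    ∃ m : ℕ, ∀ a ∈ K, ∀ (x : Lattice μ) (Λ : Finset (Lattice μ)), box x m ⊆ Λ →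
      ∀ t : ℝ, |t| ≤ T → ‖α.at t (S.τ x a) - localEvolution h Λ t (S.τ x a)‖ ≤ ε := by
  obtain ⟨F, -, hF, hcover⟩ := hK.finite_cover_balls (e := ε / 4) (by linarith)
  choose m hm using fun b : A => hα b (ε / 2) (by linarith)
  refine ⟨hF.toFinset.sup m, fun a ha x Λ hΛ t ht => ?_⟩
  obtain ⟨b, hb, hab⟩ := Set.mem_iUnion₂.1 (hcover ha)
  rw [Metric.mem_ball, dist_eq_norm] at hab
  have h₁ := hm b x Λ
    ((box_mono x (Finset.le_sup (hF.mem_toFinset.2 hb))).trans hΛ) t ht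
  have h₂ := norm_at_sub_localEvolution_le (α := α) hh Λ t (S.τ x a) (S.τ x b)
  rw [← map_sub, S.norm_τ] at h₂
  linarith

theorem two_mul (hh : ∀ x, IsSelfAdjoint (h x)) (hinv : α.IsTranslationInvariant S)
    (hcont : α.IsStronglyContinuous) {T : ℝ} (hα : α.IsUniformlyApproximated S h T) :
    α.IsUniformlyApproximated S h (2 * T) := by
  intro a ε hε
  obtain ⟨m₁, hm₁⟩ := hα a (ε / 2) (by linarith)
  obtain ⟨m₂, hm₂⟩ := hα.exists_forall_mem_of_isCompact hh
    ((isCompact_Icc (a := -T) (b := T)).image (hcont.continuous a)) (ε := ε / 2) (by linarith)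
  refine ⟨max m₁ m₂, fun x Λ hΛ t ht => ?_⟩
  have hs : |t / 2| ≤ T := by
    rw [abs_div, abs_two]
    linarith
  have h₁ := hm₁ x Λ ((box_mono x (le_max_left _ _)).trans hΛ) _ hs
  have h₂ := hm₂ _ (Set.mem_image_of_mem _ (abs_le.1 hs)) x Λ
    ((box_mono x (le_max_right _ _)).trans hΛ) _ hs
  -- Translation invariance identifies the translate of a point of the compact orbit with the
  -- evolved translate of `a`.
  rw [← hinv] at h₂
  rw [← norm_localEvolution Λ hh (t / 2), localEvolution_sub] at h₁
  rw [← add_halves t, α.at_add, localEvolution_add]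
  linarith [norm_sub_le_norm_sub_add_norm_sub (α.at (t / 2) (α.at (t / 2) (S.τ x a)))
    (localEvolution h Λ (t / 2) (α.at (t / 2) (S.τ x a)))
    (localEvolution h Λ (t / 2) (localEvolution h Λ (t / 2) (S.τ x a)))]

end TimeEvolution.IsUniformlyApproximated

theorem isUniformlyApproximated (hh : S.IsLocalHamiltonian h R N)
    (hinv : α.IsTranslationInvariant S) (hcont : α.IsStronglyContinuous)
    (hα : α.IsApproximatelyInner h) (T : ℝ) : α.IsUniformlyApproximated S h T := by
  have hN := hh.nonneg
  set c : ℝ := 8 * N * ((2 * R + 1) ^ μ) ^ 2 with hc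
  have hc0 : 0 ≤ c := by positivity
  -- The `+ 1` keeps the starting time finite and positive even if `c = 0`.
  have key : ∀ k : ℕ, α.IsUniformlyApproximated S h (2 ^ k * (1 / (c + 1))) := by
    intro k
    induction k with
    | zero =>
      refine isUniformlyApproximated_of_mul_le_one hh hα ?_
      rw [← hc, pow_zero, one_mul, one_div_mul_eq_div, div_le_one (by positivity)]
      linarith
    | succ k ih =>
      rw [pow_succ', mul_assoc]
      exact ih.two_mul hh.isSelfAdjoint hinv hcont
  obtain ⟨k, hk⟩ := pow_unbounded_of_one_lt (T * (c + 1)) one_lt_two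
  intro a ε hε
  obtain ⟨m, hm⟩ := key k a ε hε
  refine ⟨m, fun x Λ hΛ t ht => hm x Λ hΛ t (ht.trans ?_)⟩
  rw [mul_one_div, le_div_iff₀ (by positivity)]
  exact hk.le

theorem norm_at_average_sub_localEvolution_le (hh : ∀ x, IsSelfAdjoint (h x)) (a : A) (m : ℕ)
    (Λ : Finset (Lattice μ)) (t ε : ℝ) (hε : 0 ≤ ε)
    (hm : ∀ x, box x m ⊆ Λ → ‖α.at t (S.τ x a) - localEvolution h Λ t (S.τ x a)‖ ≤ ε) :
    ‖α.at t (S.average a Λ) - localEvolution h Λ t (S.average a Λ)‖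
      ≤ (Λ.card : ℝ)⁻¹ * (Λ.card * ε + (boundary m Λ).card * (2 * ‖a‖)) := by
  rw [SpinSystem.average, map_smul, localEvolution_smul, ← smul_sub, norm_smul, norm_inv,
    Complex.norm_natCast, map_sum, localEvolution_sum, ← Finset.sum_sub_distrib]
  refine mul_le_mul_of_nonneg_left ?_ (by positivity)
  rw [← nsmul_eq_mul, ← nsmul_eq_mul, ← Finset.sum_const, ← Finset.sum_const, boundary,
    Finset.sum_filter, ← Finset.sum_add_distrib]
  refine norm_sum_le_of_le _ fun x _ => ?_
  split_ifs with hx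
  · rw [add_zero]
    exact hm x hx
  · have := norm_sub_le (α.at t (S.τ x a)) (localEvolution h Λ t (S.τ x a))
    rw [α.norm_at, norm_localEvolution Λ hh, S.norm_τ] at this
    linarith

end QuantumSpin

theorem mainTheorem4 {μ d : ℕ} {A : Type*} [CStarAlgebra A]
    (S : QuantumSpin.SpinSystem μ d A)
    (h : QuantumSpin.Lattice μ → A) (R : ℕ) (N : ℝ) (hh : S.IsLocalHamiltonian h R N)
    (α : QuantumSpin.TimeEvolution A)
    (hα_trans : α.IsTranslationInvariant S)
    (hα_cont : α.IsStronglyContinuous)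
    (hα_inner : α.IsApproximatelyInner h)
    (A₀ : A) (hA₀ : S.IsLocal A₀) (ε : ℝ) (hε : 0 < ε) (t₀ : ℝ) (ht₀ : 0 < t₀) :
    ∀ᶠ Λ in QuantumSpin.vanHove μ, ∀ t ∈ Set.Icc (-t₀) t₀,
      ‖α.at t (S.average A₀ Λ)
        - QuantumSpin.localEvolution h Λ t (S.average A₀ Λ)‖ ≤ ε := by
  obtain ⟨m, hm⟩ := QuantumSpin.isUniformlyApproximated hh hα_trans hα_cont hα_inner t₀ A₀
    (ε / 2) (by linarith)
  -- The boundary gets the other half of `ε`; the `+ 1` covers `A₀ = 0`.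
  set δ : ℝ := ε / 2 / (2 * ‖A₀‖ + 1) with hδ
  have hδ0 : 0 < δ := by positivity
  have hev : ∀ᶠ Λ in QuantumSpin.vanHove μ,
      ((QuantumSpin.boundary m Λ).card : ℝ) / (Λ.card : ℝ) < δ :=
    (tendsto_comap.mono_left (inf_le_left.trans (iInf_le _ m))).eventually (gt_mem_nhds hδ0)
  have hne : ∀ᶠ Λ in QuantumSpin.vanHove μ, Λ.Nonempty :=
    mem_inf_of_right (mem_principal_self _)
  filter_upwards [hev, hne] with Λ hΛ hΛne t ht
  have hcard : (0 : ℝ) < Λ.card := by exact_mod_cast hΛne.card_pos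
  refine (QuantumSpin.norm_at_average_sub_localEvolution_le hh.isSelfAdjoint A₀ m Λ t (ε / 2)
    (by positivity) fun x hx => hm x Λ hx t (abs_le.2 ht)).trans ?_
  rw [mul_add, ← mul_assoc, inv_mul_cancel₀ hcard.ne', one_mul, ← mul_assoc, inv_mul_eq_div]
  have h₁ : ((QuantumSpin.boundary m Λ).card : ℝ) / (Λ.card : ℝ) * (2 * ‖A₀‖) ≤ δ * (2 * ‖A₀‖ + 1) :=
    mul_le_mul hΛ.le (by linarith) (by positivity) hδ0.le
  have h₂ : δ * (2 * ‖A₀‖ + 1) = ε / 2 := div_mul_cancel₀ _ (by positivity)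
  linarith
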